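/- **Setting.** Let $K\subseteq\mathbb{R}^d$ be closed and convex with $r\mathbb{B}\subseteq K\subseteq R\mathbb{B}$ for some $r,R>0$, where $\mathbb{B}$ is the closed Euclidean unit ball and $\mathbb{S}$ the unit sphere. Let $G\ge 0$. In each round $t=1,2,\dots$ an adversary selects a (possibly random) loss $\ell_t$ that is $G$-Lipschitz, differentiable and convex on $K$. Let $0<\delta\le r$ and $\eta>0$. Online stochastic gradient descent (OSGD) on $(1-\frac{\delta}{r})K$ with two-point gradient estimates starts at $x_1=0$ and, in round $t$, draws $S_t$ uniformly from $\mathbb{S}$, queries $\ell_t$ at $X_t^+=x_t+\delta S_t$ and $X_t^-=x_t-\delta S_t$, plays $\widetilde X_t$, one of these two points selected by a fair coin, and sets $$\widetilde g_t=\frac{d}{2\delta}\bigl(\ell_t(X_t^+)-\ell_t(X_t^-)\bigr)S_t,\qquad x_{t+1}=\mathop{\mathrm{argmin}}_{y\in(1-\delta/r)K}\bigl\|y-(x_t-\eta\,\widetilde g_t)\bigr\|.$$ The adversary may be adaptive and randomized: there is a filtration $(\mathcal{F}_t)_{t\ge1}$ such that $\ell_t(x)$ is $\mathcal{F}_t$-measurable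 and integrable for every $x\in K$, $S_t$ and the coin of round $t$ are $\mathcal{F}_{t+1}$-measurable, and they are independent of each other and, jointly, of $\mathcal{F}_t$. (For deterministic losses this just says that all directions and coins are independent.) The pseudo-regret is $$\overline R_n=\mathbb{E}\sum_{t=1}^n\ell_t(\widetilde X_t)-\min_{x\in K}\mathbb{E}\sum_{t=1}^n\ell_t(x).$$ **Theorem (regret of OSGD with two-point feedback).** All query points $X_t^\pm$ lie in $K$, the expectations and the minimum defining $\overline R_n$ exist, and for every $n\ge 0$ $$\overline R_n\le\frac{R^2}{\eta}+\eta(Gd)^2n+\delta\Bigl(3+\frac{R}{r}\Bigr)Gn.$$ Moreover, if $G>0$, $n\ge1$ and $\eta=\frac{R}{Gd\sqrt n}$, then in the limit $\delta\to0$ one has $\overline R_n\le 2RGd\sqrt n$, uniformly over all adversaries: for every $\varepsilon>0$ there is $\delta_0>0$ such that $\overline R_n\le 2RGd\sqrt n+\varepsilon$ for all $0<\delta<\delta_0$ and every adversary. -/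

import Mathlib

open MeasureTheory ProbabilityTheory Filter Topology
open scoped NNReal Pointwise

/-- `C`-valued Euclidean projection `argmin_{y ∈ C} ‖y - z‖` (with value `0` when no minimizer
exists, which does not happen for nonempty closed sets). -/
noncomputable def euclProj {d : ℕ} (C : Set (EuclideanSpace ℝ (Fin d)))
    (z : EuclideanSpace ℝ (Fin d)) : EuclideanSpace ℝ (Fin d) :=
  open Classical in
  if h : ∃ y, y ∈ C ∧ IsMinOn (fun w => ‖w - z‖) C y then h.choose else 0

/-- The projection on a nonempty closed set is a minimizer of the distance. -/
theorem euclProj_spec {d : ℕ} {C : Set (EuclideanSpace ℝ (Fin d))} (hC : IsClosed C)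
    (hne : C.Nonempty) (z : EuclideanSpace ℝ (Fin d)) :
    euclProj C z ∈ C ∧ IsMinOn (fun w => ‖w - z‖) C (euclProj C z) := by
  have h : ∃ y, y ∈ C ∧ IsMinOn (fun w => ‖w - z‖) C y := by
    obtain ⟨y, hy, hyz⟩ := hC.exists_infDist_eq_dist hne z
    refine ⟨y, hy, fun w hw => ?_⟩
    have h1 := Metric.infDist_le_dist_of_mem (x := z) hw
    rw [hyz, dist_comm z y, dist_comm z w, dist_eq_norm, dist_eq_norm] at h1
    exact h1
  unfold euclProj
  rw [dif_pos h]
  exact h.choose_spec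

/-- The OSGD iterates on the set `C` with learning rate `η`, where `g t x` is the gradient
estimate observed in round `t` at the point `x`. Rounds are numbered from `0`. -/
noncomputable def osgd {d : ℕ} (C : Set (EuclideanSpace ℝ (Fin d))) (η : ℝ)
    (g : ℕ → EuclideanSpace ℝ (Fin d) → EuclideanSpace ℝ (Fin d)) :
    ℕ → EuclideanSpace ℝ (Fin d)
  | 0 => 0
  | t + 1 => euclProj C (osgd C η g t - η • g t (osgd C η g t))

/-- The two-point gradient estimate `(d / 2δ) (ℓ(x + δ s) - ℓ(x - δ s)) s`. -/
noncomputable def twoPointGrad {d : ℕ} (δ : ℝ) (ℓ : EuclideanSpace ℝ (Fin d) → ℝ)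
    (x s : EuclideanSpace ℝ (Fin d)) : EuclideanSpace ℝ (Fin d) :=
  ((d : ℝ) / (2 * δ) * (ℓ (x + δ • s) - ℓ (x - δ • s))) • s

/-- The uniform probability distribution on the unit sphere: normalized surface measure. -/
noncomputable def uniformSphere (d : ℕ) :
    Measure (Metric.sphere (0 : EuclideanSpace ℝ (Fin d)) 1) :=
  ((volume : Measure (EuclideanSpace ℝ (Fin d))).toSphere Set.univ)⁻¹ •
    (volume : Measure (EuclideanSpace ℝ (Fin d))).toSphere

/-- Real functions that are `G`-Lipschitz, differentiable and convex on `K`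
(only their values on `K` matter). -/
def lossClass {d : ℕ} (K : Set (EuclideanSpace ℝ (Fin d))) (G : ℝ≥0) :
    Set (EuclideanSpace ℝ (Fin d) → ℝ) :=
  {ℓ | LipschitzOnWith G ℓ K ∧ DifferentiableOn ℝ ℓ K ∧ ConvexOn ℝ K ℓ}

/-- The randomness of the two-point bandit game against an arbitrary, possibly randomized and
adaptive, adversary. `ℱ t` is everything that may be known when the loss `ℓ t` is chosen: it
contains the forecaster's draws of the rounds before `t`, and possibly private randomness of the
adversary. `S t` is the random direction and `σ t` the fair coin that selects the played point
in round `t`; the pair is drawn afresh, independently of `ℱ t`. -/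
structure IsTwoPointGame {d : ℕ} (K : Set (EuclideanSpace ℝ (Fin d))) (G : ℝ≥0)
    {Ω : Type*} [mΩ : MeasurableSpace Ω] (P : Measure Ω) (ℱ : Filtration ℕ mΩ)
    (ℓ : ℕ → Ω → EuclideanSpace ℝ (Fin d) → ℝ)
    (S : ℕ → Ω → Metric.sphere (0 : EuclideanSpace ℝ (Fin d)) 1) (σ : ℕ → Ω → Bool) :
    Prop where
  loss_mem : ∀ t ω, ℓ t ω ∈ lossClass K G
  loss_measurable : ∀ t, ∀ x ∈ K, Measurable[ℱ t] (fun ω => ℓ t ω x)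
  loss_integrable : ∀ t, ∀ x ∈ K, Integrable (fun ω => ℓ t ω x) P
  dir_measurable : ∀ t, Measurable[ℱ (t + 1)] (S t)
  coin_measurable : ∀ t, Measurable[ℱ (t + 1)] (σ t)
  draw_law : ∀ t, P.map (fun ω => (S t ω, σ t ω)) =
    (uniformSphere d).prod (uniformOn (Set.univ : Set Bool))
  draw_indep : ∀ t,
    Indep (MeasurableSpace.comap (fun ω => (S t ω, σ t ω)) inferInstance) (ℱ t) P

/-- The point `x_t` of OSGD run on `(1 - δ/r) K` with the two-point gradient estimates. -/
noncomputable def osgdIterate {d : ℕ} (K : Set (EuclideanSpace ℝ (Fin d))) (r δ η : ℝ)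
    {Ω : Type*} (ℓ : ℕ → Ω → EuclideanSpace ℝ (Fin d) → ℝ)
    (S : ℕ → Ω → Metric.sphere (0 : EuclideanSpace ℝ (Fin d)) 1) (t : ℕ) (ω : Ω) :
    EuclideanSpace ℝ (Fin d) :=
  osgd ((1 - δ / r) • K) η (fun s x => twoPointGrad δ (ℓ s ω) x (S s ω)) t

/-- The query point `X_t⁺ = x_t + δ S_t`. -/
noncomputable def queryPlus {d : ℕ} (K : Set (EuclideanSpace ℝ (Fin d))) (r δ η : ℝ)
    {Ω : Type*} (ℓ : ℕ → Ω → EuclideanSpace ℝ (Fin d) → ℝ)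
    (S : ℕ → Ω → Metric.sphere (0 : EuclideanSpace ℝ (Fin d)) 1) (t : ℕ) (ω : Ω) :
    EuclideanSpace ℝ (Fin d) :=
  osgdIterate K r δ η ℓ S t ω + δ • (S t ω : EuclideanSpace ℝ (Fin d))

/-- The query point `X_t⁻ = x_t - δ S_t`. -/
noncomputable def queryMinus {d : ℕ} (K : Set (EuclideanSpace ℝ (Fin d))) (r δ η : ℝ)
    {Ω : Type*} (ℓ : ℕ → Ω → EuclideanSpace ℝ (Fin d) → ℝ)
    (S : ℕ → Ω → Metric.sphere (0 : EuclideanSpace ℝ (Fin d)) 1) (t : ℕ) (ω : Ω) :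
    EuclideanSpace ℝ (Fin d) :=
  osgdIterate K r δ η ℓ S t ω - δ • (S t ω : EuclideanSpace ℝ (Fin d))

/-- The played point: one of the two query points, selected by the coin. -/
noncomputable def played {d : ℕ} (K : Set (EuclideanSpace ℝ (Fin d))) (r δ η : ℝ)
    {Ω : Type*} (ℓ : ℕ → Ω → EuclideanSpace ℝ (Fin d) → ℝ)
    (S : ℕ → Ω → Metric.sphere (0 : EuclideanSpace ℝ (Fin d)) 1) (σ : ℕ → Ω → Bool)
    (t : ℕ) (ω : Ω) : EuclideanSpace ℝ (Fin d) :=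
  if σ t ω = true then queryPlus K r δ η ℓ S t ω else queryMinus K r δ η ℓ S t ω

/-- The pseudo-regret
`E ∑_{t < n} ℓ_t(X_t) - min_{x ∈ K} E ∑_{t < n} ℓ_t(x)` of playing the points `X t`. -/
noncomputable def pseudoRegret {d : ℕ} (K : Set (EuclideanSpace ℝ (Fin d)))
    {Ω : Type*} [MeasurableSpace Ω] (P : Measure Ω)
    (ℓ : ℕ → Ω → EuclideanSpace ℝ (Fin d) → ℝ) (X : ℕ → Ω → EuclideanSpace ℝ (Fin d))
    (n : ℕ) : ℝ :=
  (∫ ω, ∑ t ∈ Finset.range n, ℓ t ω (X t ω) ∂P) -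
    ⨅ x : K, ∫ ω, ∑ t ∈ Finset.range n, ℓ t ω (x : EuclideanSpace ℝ (Fin d)) ∂P

/-! # Regret of online stochastic gradient descent with two-point feedback

Gradient descent never sees the gradient of `ℓ_t`, only `g = (d / 2δ) (ℓ_t(x + δs) - ℓ_t(x - δs)) s`
with `s` uniform on the sphere. The analysis rests on two facts about `g`. First, it is small
whatever `s` is: `‖g‖ ≤ G d`, because the two queries are `2δ` apart (`norm_twoPointGrad_le`); so the
usual descent inequality bounds `∑ ⟪g_t, x_t - y⟫` along every sample path (`sum_inner_osgd_le`).
Second, `g` is on average the gradient of a smoothed convex loss, so that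
`ℓ(x) - ℓ(y) - 2Gδ ≤ E ⟪g, x - y⟫` (`sub_le_integral_inner_twoPointGrad`).

The second fact is the divergence theorem on the ball. Only an inequality is needed, for Lipschitz
functions: if the derivative of `φ` in the direction `u` is at most `c` on the unit ball, then
`d ∫_S φ(s) ⟪s, u⟫ ≤ c |S|` (`finrank_mul_integral_sphere_inner_le`). To prove it, integrate the
derivative of `φ` by parts against `k_m(x) = 1 - ‖x‖ ^ m` (cut off at the sphere). The derivative of
`k_m` is `-m ‖x‖ ^ (m - 1)` times the radial direction, which concentrates on the sphere as
`m → ∞`; all integrals of powers of the norm are computed in polar coordinates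
(`setIntegral_ball_norm_pow_mul_angular`). The lemma is applied to minus the odd part of
`z ↦ ℓ(x + δz)`, whose directional derivative in the direction `x - y` is bounded by convexity.

For the game itself, the iterate `x_t` is `ℱ t`-measurable and the direction `S t` is independent of
`ℱ t`, so the expectation over the round can be taken over `S t` first, with the loss and the iterate
frozen (`IndepFun.integral_comp_prodMk`, `IsTwoPointGame.integral_loss_sub_le`). Replacing the played
point by `x_t` costs `Gδ`, replacing the comparator `y ∈ K` by `(1 - δ/r) y` costs `GδR/r`, and
smoothing costs `2Gδ`. This yields the bound with `R² / (2η) + η (Gd)² / 2 · n`, half of what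
is claimed in these two terms.
-/

/-! ### Polar coordinates -/

section Polar

variable {E : Type*} [NormedAddCommGroup E] [NormedSpace ℝ E] [FiniteDimensional ℝ E]
  [Nontrivial E] [MeasurableSpace E] [BorelSpace E]

/-- The integral of a product of a radial and an angular function splits. No integrability is
needed: `integral_prod_mul` holds with the default value `0` as well. -/
theorem integral_radial_mul_angular (μ : Measure E) [μ.IsAddHaarMeasure] (j : ℝ → ℝ)
    (f : E → ℝ) :
    ∫ x, j ‖x‖ * f (‖x‖⁻¹ • x) ∂μ =
      (∫ y in Set.Ioi (0 : ℝ), y ^ (Module.finrank ℝ E - 1) * j y) *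
        ∫ s, f (s : E) ∂μ.toSphere := by
  calc
    ∫ x, j ‖x‖ * f (‖x‖⁻¹ • x) ∂μ
        = ∫ x : ({(0)}ᶜ : Set E), j ‖x.1‖ * f (‖x.1‖⁻¹ • x.1) ∂(μ.comap (↑)) := by
      rw [integral_subtype_comap (measurableSet_singleton _).compl
        fun x ↦ j ‖x‖ * f (‖x‖⁻¹ • x), restrict_compl_singleton]
    _ = ∫ x, f (x.1 : E) * j x.2
          ∂μ.toSphere.prod (.volumeIoiPow (Module.finrank ℝ E - 1)) := by
      simpa [mul_comm] using μ.measurePreserving_homeomorphUnitSphereProd.integral_comp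
        (Homeomorph.measurableEmbedding _)
        (fun x : Metric.sphere (0 : E) 1 × Set.Ioi (0 : ℝ) ↦ f (x.1 : E) * j x.2)
    _ = (∫ s, f (s : E) ∂μ.toSphere) *
          ∫ y : Set.Ioi (0 : ℝ), j y ∂.volumeIoiPow (Module.finrank ℝ E - 1) :=
      integral_prod_mul (fun s : Metric.sphere (0 : E) 1 ↦ f (s : E))
        (fun y : Set.Ioi (0 : ℝ) ↦ j y)
    _ = _ := by
      rw [mul_comm]
      congr 1
      simp only [Measure.volumeIoiPow, ENNReal.ofReal]
      rw [integral_withDensity_eq_integral_smul,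
        integral_subtype_comap measurableSet_Ioi
          fun a ↦ Real.toNNReal (a ^ (Module.finrank ℝ E - 1)) • j a,
        setIntegral_congr_fun measurableSet_Ioi fun x hx ↦ ?_]
      · simp only [NNReal.smul_def, smul_eq_mul]
        rw [Real.coe_toNNReal _ (pow_nonneg (Set.mem_Ioi.1 hx).le _)]
      · exact (measurable_subtype_coe.pow_const _).real_toNNReal

theorem setIntegral_ball_norm_pow_mul_angular (μ : Measure E) [μ.IsAddHaarMeasure] (p : ℕ)
    (f : E → ℝ) :
    ∫ x in Metric.ball (0 : E) 1, ‖x‖ ^ p * f (‖x‖⁻¹ • x) ∂μ =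
      ((p : ℝ) + Module.finrank ℝ E)⁻¹ * ∫ s, f (s : E) ∂μ.toSphere := by
  have hd : 0 < Module.finrank ℝ E := Module.finrank_pos
  have h := integral_radial_mul_angular μ ((Set.Iio (1 : ℝ)).indicator (· ^ p)) f
  have h1 : ∫ x in Metric.ball (0 : E) 1, ‖x‖ ^ p * f (‖x‖⁻¹ • x) ∂μ =
      ∫ x, (Set.Iio (1 : ℝ)).indicator (· ^ p) ‖x‖ * f (‖x‖⁻¹ • x) ∂μ := by
    rw [← integral_indicator measurableSet_ball]
    refine integral_congr_ae (.of_forall fun x => ?_)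
    by_cases hx : ‖x‖ < 1 <;> simp [Set.indicator, hx]
  rw [h1, h]
  congr 1
  have h2 : ∀ y : ℝ, y ^ (Module.finrank ℝ E - 1) * (Set.Iio (1 : ℝ)).indicator (· ^ p) y =
      (Set.Iio (1 : ℝ)).indicator (· ^ (p + (Module.finrank ℝ E - 1))) y := by
    intro y
    by_cases hy : y < 1 <;> simp [Set.indicator, hy, pow_add, mul_comm]
  simp_rw [h2]
  rw [setIntegral_indicator measurableSet_Iio, Set.Ioi_inter_Iio,
    ← integral_Ioc_eq_integral_Ioo, ← intervalIntegral.integral_of_le zero_le_one, integral_pow]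
  have h3 : ((p + (Module.finrank ℝ E - 1) : ℕ) : ℝ) + 1 = p + Module.finrank ℝ E := by
    have : p + (Module.finrank ℝ E - 1) + 1 = p + Module.finrank ℝ E := by omega
    exact_mod_cast this
  rw [h3]
  simp

end Polar

/-! ### A divergence inequality on the unit ball -/

section Stokes

variable {E : Type*} [NormedAddCommGroup E]

/-- The function `1 - ‖x‖ ^ m` on the unit ball, extended by `0`: a Lipschitz, compactly supported
approximation of the indicator function of the ball for large `m`. -/
noncomputable def powerBump (m : ℕ) (x : E) : ℝ := 1 - min ‖x‖ 1 ^ m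

theorem lipschitzWith_powerBump (m : ℕ) : LipschitzWith m (powerBump m : E → ℝ) := by
  refine LipschitzWith.of_dist_le_mul fun x y => ?_
  have h := abs_pow_sub_pow_le (min ‖x‖ 1) (min ‖y‖ 1) m
  have hx : |min ‖x‖ 1| ≤ 1 := by
    rw [abs_of_nonneg (le_min (norm_nonneg _) zero_le_one)]; exact min_le_right _ _
  have hy : |min ‖y‖ 1| ≤ 1 := by
    rw [abs_of_nonneg (le_min (norm_nonneg _) zero_le_one)]; exact min_le_right _ _
  have h1 : |min ‖x‖ 1 - min ‖y‖ 1| ≤ ‖x - y‖ :=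
    ((abs_min_sub_min_le_max _ _ _ _).trans (by simp)).trans (abs_norm_sub_norm_le x y)
  have h2 : max |min ‖x‖ 1| |min ‖y‖ 1| ^ (m - 1) ≤ 1 :=
    pow_le_one₀ (le_max_of_le_left (abs_nonneg _)) (max_le hx hy)
  rw [Real.dist_eq, dist_eq_norm, powerBump, powerBump, sub_sub_sub_cancel_left, abs_sub_comm]
  calc _ ≤ _ := h
    _ ≤ ‖x - y‖ * m * 1 := by gcongr
    _ = _ := by push_cast; ring

theorem powerBump_eq_zero {m : ℕ} {x : E} (hx : x ∉ Metric.ball (0 : E) 1) :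
    powerBump m x = 0 := by
  have : 1 ≤ ‖x‖ := by simpa using hx
  simp [powerBump, min_eq_right this]

theorem powerBump_of_mem_ball {m : ℕ} {x : E} (hx : x ∈ Metric.ball (0 : E) 1) :
    powerBump m x = 1 - ‖x‖ ^ m := by
  have : ‖x‖ < 1 := by simpa using hx
  simp [powerBump, min_eq_left this.le]

variable [InnerProductSpace ℝ E]

theorem hasCompactSupport_powerBump [FiniteDimensional ℝ E] (m : ℕ) :
    HasCompactSupport (powerBump m : E → ℝ) :=
  HasCompactSupport.of_support_subset_isCompact (isCompact_closedBall (0 : E) 1) fun x hx => by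
    by_contra h
    exact hx (powerBump_eq_zero fun h' => h (Metric.ball_subset_closedBall h'))

/-- The direction is `-u` because that is what integration by parts produces. The centre is
excluded, where the norm need not be differentiable. -/
theorem lineDeriv_powerBump_of_mem_ball (m : ℕ) (u : E) {x : E} (hx : x ∈ Metric.ball (0 : E) 1)
    (hx0 : x ≠ 0) :
    lineDeriv ℝ (powerBump m) x (-u) =
      m * (‖x‖ ^ (m - 1) * inner ℝ (‖x‖⁻¹ • x) u) := by
  have h1 : HasDerivAt (fun t : ℝ => ‖x + t • (-u)‖) (inner ℝ (‖x‖⁻¹ • x) (-u)) 0 := by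
    have hs : HasDerivAt (fun t : ℝ => x + t • (-u)) (-u) 0 := by
      simpa using ((hasDerivAt_id (0 : ℝ)).smul_const (-u)).const_add x
    have h2 := hs.norm_sq
    have h3 := h2.sqrt (by simpa using hx0)
    simp only [Real.sqrt_sq (norm_nonneg _)] at h3
    convert h3 using 1
    have : ‖x‖ ≠ 0 := norm_ne_zero_iff.2 hx0
    simp [real_inner_smul_left]
    field_simp
  have h2 : HasDerivAt (fun t : ℝ => powerBump m (x + t • (-u)))
      (-(m * ‖x‖ ^ (m - 1) * inner ℝ (‖x‖⁻¹ • x) (-u))) 0 := by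
    have h3 := (h1.pow m).const_sub 1
    simp only [zero_smul, add_zero] at h3
    refine h3.congr_of_eventuallyEq ?_
    have hc : Continuous fun t : ℝ => x + t • (-u) := by fun_prop
    have : ∀ᶠ t in 𝓝 (0 : ℝ), x + t • (-u) ∈ Metric.ball (0 : E) 1 :=
      hc.continuousAt.eventually_mem (Metric.isOpen_ball.mem_nhds (by simpa using hx))
    filter_upwards [this] with t ht
    rw [powerBump_of_mem_ball ht]
    rfl
  rw [lineDeriv, h2.deriv]
  simp [mul_assoc]

theorem lineDeriv_powerBump_of_notMem_closedBall (m : ℕ) (u : E) {x : E}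
    (hx : x ∉ Metric.closedBall (0 : E) 1) :
    lineDeriv ℝ (powerBump m) x u = 0 := by
  have hc : Continuous fun t : ℝ => x + t • u := by fun_prop
  have : ∀ᶠ t in 𝓝 (0 : ℝ), x + t • u ∈ (Metric.closedBall (0 : E) 1)ᶜ :=
    hc.continuousAt.eventually_mem
      (Metric.isClosed_closedBall.isOpen_compl.mem_nhds (by simpa using hx))
  have h2 : (fun t : ℝ => powerBump m (x + t • u)) =ᶠ[𝓝 0] fun _ => (0 : ℝ) := by
    filter_upwards [this] with t ht
    exact powerBump_eq_zero fun h => ht (Metric.ball_subset_closedBall h)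
  rw [lineDeriv, h2.deriv_eq]
  simp

variable [FiniteDimensional ℝ E] [Nontrivial E] [MeasurableSpace E] [BorelSpace E]

theorem lineDeriv_powerBump_ae_eq (μ : Measure E) [μ.IsAddHaarMeasure] (m : ℕ) (u : E) :
    (fun x => lineDeriv ℝ (powerBump m) x (-u)) =ᵐ[μ]
      (Metric.ball (0 : E) 1).indicator
        fun x => m * (‖x‖ ^ (m - 1) * inner ℝ (‖x‖⁻¹ • x) u) := by
  have h0 : ∀ᵐ x ∂μ, x ≠ 0 := by
    simp [ae_iff]
  have h1 : ∀ᵐ x ∂μ, x ∉ Metric.sphere (0 : E) 1 := by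
    have := Measure.addHaar_sphere μ (0 : E) 1
    exact measure_eq_zero_iff_ae_notMem.1 this
  filter_upwards [h0, h1] with x hx0 hx1
  by_cases hx : x ∈ Metric.ball (0 : E) 1
  · rw [Set.indicator_of_mem hx, lineDeriv_powerBump_of_mem_ball m u hx hx0]
  · rw [Set.indicator_of_notMem hx]
    refine lineDeriv_powerBump_of_notMem_closedBall m _ fun h => ?_
    rcases (Metric.ball_union_sphere (x := (0 : E)) (ε := 1)).symm.subset h with h | h
    exacts [hx h, hx1 h]

/-- A one-sided divergence theorem on the unit ball: `d ∫_S φ(s) ⟪s, u⟫` would be `d ∫_B ∂_u φ`,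
and `|S| = d |B|`. -/
theorem finrank_mul_integral_sphere_inner_le (μ : Measure E) [μ.IsAddHaarMeasure] {φ : E → ℝ}
    {L : ℝ≥0} (hφ : LipschitzWith L φ) (u : E) {c : ℝ}
    (hc : ∀ x ∈ Metric.ball (0 : E) 1, lineDeriv ℝ φ x u ≤ c) :
    Module.finrank ℝ E * ∫ s, φ (s : E) * inner ℝ (s : E) u ∂μ.toSphere ≤
      c * μ.toSphere.real Set.univ := by
  set d := Module.finrank ℝ E with hd
  have hd0 : 0 < (d : ℝ) := by exact_mod_cast Module.finrank_pos
  set B := Metric.ball (0 : E) 1 with hB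
  set I := ∫ s, φ (s : E) * inner ℝ (s : E) u ∂μ.toSphere with hI
  set A := μ.toSphere.real Set.univ with hA
  have hpow : ∀ p : ℕ, ∫ x in B, ‖x‖ ^ p ∂μ = ((p : ℝ) + d)⁻¹ * A := by
    intro p
    simpa [hA] using setIntegral_ball_norm_pow_mul_angular μ p (fun _ : E => (1 : ℝ))
  have hBfin : μ B ≠ ⊤ := measure_ball_lt_top.ne
  -- Bounded measurable functions on the ball are integrable.
  have hint : ∀ (f : E → ℝ) (C : ℝ), Measurable f → (∀ x ∈ B, |f x| ≤ C) →
      IntegrableOn f B μ := by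
    intro f C hf hC
    refine Measure.integrableOn_of_bounded (M := C) hBfin hf.aestronglyMeasurable ?_
    filter_upwards [ae_restrict_mem measurableSet_ball] with x hx using hC x hx
  have hn1 : ∀ x ∈ B, ‖x‖ ≤ 1 := fun x hx => (by simpa [hB] using hx : ‖x‖ < 1).le
  have hpow1 : ∀ (p : ℕ), ∀ x ∈ B, |‖x‖ ^ p| ≤ 1 := fun p x hx => by
    rw [abs_of_nonneg (by positivity)]; exact pow_le_one₀ (norm_nonneg _) (hn1 x hx)
  have hunit : ∀ x : E, ‖‖x‖⁻¹ • x‖ ≤ 1 := fun x => by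
    rw [norm_smul, norm_inv, norm_norm]; exact inv_mul_le_one
  have hinner : ∀ x : E, |inner ℝ (‖x‖⁻¹ • x) u| ≤ ‖u‖ := fun x =>
    (abs_real_inner_le_norm _ _).trans (by nlinarith [hunit x, norm_nonneg u])
  have hφb : ∀ x : E, ‖x‖ ≤ 1 → |φ x| ≤ |φ 0| + L := fun x hx => by
    have h := hφ.dist_le_mul x 0
    rw [dist_zero_right, Real.dist_eq] at h
    have h2 : |φ x| ≤ |φ 0| + |φ x - φ 0| := by
      simpa using abs_add_le (φ 0) (φ x - φ 0)
    nlinarith [L.coe_nonneg]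
  have hφm : Measurable φ := hφ.continuous.measurable
  -- The estimate obtained from the bump with exponent `q + 1`, divided by `q + 1`.
  have key : ∀ q : ℕ, I / (q + d) - L * ‖u‖ * A / ((q + d) * (q + 1 + d)) ≤
      c * A / (d * (q + 1 + d)) := by
    intro q
    have hq : (0 : ℝ) < q + 1 := by positivity
    have hparts := hφ.integral_lineDeriv_mul_eq (μ := μ) (lipschitzWith_powerBump (E := E) (q + 1))
      (hasCompactSupport_powerBump (q + 1)) u
    -- The derivative of `φ` integrates to at most `c` times the mass of the bump.
    have hleft : ∫ x, lineDeriv ℝ φ x u * powerBump (q + 1) x ∂μ ≤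
        c * A * (q + 1) / (d * (q + 1 + d)) := by
      have e1 : ∫ x, lineDeriv ℝ φ x u * powerBump (q + 1) x ∂μ =
          ∫ x in B, lineDeriv ℝ φ x u * (1 - ‖x‖ ^ (q + 1)) ∂μ := by
        rw [← integral_indicator measurableSet_ball]
        refine integral_congr_ae (.of_forall fun x => ?_)
        by_cases hx : x ∈ B
        · simp only [← hB, Set.indicator_of_mem hx, powerBump_of_mem_ball hx]
        · simp only [← hB, Set.indicator_of_notMem hx, powerBump_eq_zero hx, mul_zero]
      have e2 : ∫ x in B, c * (1 - ‖x‖ ^ (q + 1)) ∂μ = c * A * (q + 1) / (d * (q + 1 + d)) := by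
        rw [integral_const_mul, integral_sub (hint _ 1 measurable_const (by simp))
          (hint _ 1 (by fun_prop) (hpow1 (q + 1))), hpow]
        have := hpow 0
        simp only [pow_zero, Nat.cast_zero, zero_add] at this
        rw [this]
        push_cast
        field_simp
        ring
      rw [e1, ← e2]
      have hb : ∀ x ∈ B, 0 ≤ 1 - ‖x‖ ^ (q + 1) ∧ 1 - ‖x‖ ^ (q + 1) ≤ 1 := fun x hx =>
        ⟨sub_nonneg.2 (pow_le_one₀ (norm_nonneg _) (hn1 x hx)),
          sub_le_self _ (by positivity)⟩
      refine setIntegral_mono_on ?_ ?_ measurableSet_ball fun x hx =>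
        mul_le_mul_of_nonneg_right (hc x hx) (hb x hx).1
      · refine hint _ (L * ‖u‖) ((measurable_lineDeriv hφ.continuous).mul (by fun_prop))
          fun x hx => ?_
        rw [abs_mul, abs_of_nonneg (hb x hx).1]
        have := norm_lineDeriv_le_of_lipschitz ℝ hφ (x₀ := x) (v := u)
        rw [Real.norm_eq_abs] at this
        nlinarith [hb x hx, abs_nonneg (lineDeriv ℝ φ x u)]
      · refine hint _ |c| (by fun_prop) fun x hx => ?_
        rw [abs_mul, abs_of_nonneg (hb x hx).1]
        nlinarith [hb x hx, abs_nonneg c]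
    -- Moving `φ x` radially to the sphere costs at most `L (1 - ‖x‖)`, which the weight
    -- `‖x‖ ^ q` makes negligible.
    have hright : (q + 1) * (I / (q + d)) -
        (q + 1) * (L * ‖u‖ * A / ((q + d) * (q + 1 + d))) ≤
        ∫ x, lineDeriv ℝ (powerBump (q + 1)) x (-u) * φ x ∂μ := by
      have e1 : ∫ x, lineDeriv ℝ (powerBump (q + 1)) x (-u) * φ x ∂μ =
          ∫ x in B, (q + 1) * (‖x‖ ^ q * inner ℝ (‖x‖⁻¹ • x) u * φ x) ∂μ := by
        rw [← integral_indicator measurableSet_ball]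
        refine integral_congr_ae ?_
        filter_upwards [lineDeriv_powerBump_ae_eq μ (q + 1) u] with x hx
        rw [hx]
        by_cases hxB : x ∈ B
        · simp only [← hB, Set.indicator_of_mem hxB]
          push_cast
          simp [mul_assoc]
        · simp only [← hB, Set.indicator_of_notMem hxB, zero_mul]
      have e2 : ∫ x in B, ‖x‖ ^ q * (φ (‖x‖⁻¹ • x) * inner ℝ (‖x‖⁻¹ • x) u) ∂μ = I / (q + d) := by
        rw [setIntegral_ball_norm_pow_mul_angular μ q fun x => φ x * inner ℝ x u,
          div_eq_inv_mul]
      have i2 : IntegrableOn (fun x => ‖x‖ ^ q * (φ (‖x‖⁻¹ • x) * inner ℝ (‖x‖⁻¹ • x) u)) B μ := by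
        refine hint _ ((|φ 0| + L) * ‖u‖) (by fun_prop) fun x hx => ?_
        rw [abs_mul, abs_mul]
        calc _ ≤ 1 * ((|φ 0| + L) * ‖u‖) := by
              gcongr
              exacts [hpow1 q x hx, hφb _ (hunit x), hinner x]
          _ = _ := one_mul _
      have i3 : IntegrableOn (fun x : E => L * ‖u‖ * (‖x‖ ^ q - ‖x‖ ^ (q + 1))) B μ :=
        ((hint _ 1 (by fun_prop) (hpow1 q)).sub (hint _ 1 (by fun_prop) (hpow1 (q + 1)))).const_mul _
      have e3 : ∫ x in B, L * ‖u‖ * (‖x‖ ^ q - ‖x‖ ^ (q + 1)) ∂μ =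
          L * ‖u‖ * A / ((q + d) * (q + 1 + d)) := by
        rw [integral_const_mul, integral_sub (hint _ 1 (by fun_prop) (hpow1 q))
          (hint _ 1 (by fun_prop) (hpow1 (q + 1))), hpow, hpow]
        push_cast
        field_simp
        ring
      rw [e1, integral_const_mul, ← mul_sub, ← e2, ← e3, ← integral_sub i2 i3]
      refine mul_le_mul_of_nonneg_left ?_ hq.le
      refine setIntegral_mono_on (i2.sub i3) ?_ measurableSet_ball fun x hx => ?_
      · refine hint _ (‖u‖ * (|φ 0| + L)) (by fun_prop) fun x hx => ?_
        rw [abs_mul, abs_mul]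
        calc _ ≤ 1 * ‖u‖ * (|φ 0| + L) := by
              gcongr
              exacts [hpow1 q x hx, hinner x, hφb _ (hn1 x hx)]
          _ = _ := by rw [one_mul]
      · by_cases hx0 : x = 0
        · subst hx0
          -- At the centre the direction `‖x‖⁻¹ • x` is `0`, so both inner products vanish.
          rcases q with _ | q <;> simp
          positivity
        have hxn : 0 < ‖x‖ := norm_pos_iff.2 hx0
        have hdist : |φ (‖x‖⁻¹ • x) - φ x| ≤ L * (1 - ‖x‖) := by
          have h := hφ.dist_le_mul (‖x‖⁻¹ • x) x
          rw [Real.dist_eq, dist_eq_norm] at h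
          have h2 : ‖‖x‖⁻¹ • x - x‖ = 1 - ‖x‖ := by
            have h3 : ‖x‖⁻¹ • x - x = (‖x‖⁻¹ - 1) • x := by rw [sub_smul, one_smul]
            rw [h3, norm_smul, Real.norm_eq_abs, abs_of_nonneg
              (sub_nonneg.2 ((one_le_inv₀ hxn).2 (hn1 x hx))), sub_mul,
              inv_mul_cancel₀ hxn.ne', one_mul]
          rwa [h2] at h
        have h4 : (φ (‖x‖⁻¹ • x) - φ x) * inner ℝ (‖x‖⁻¹ • x) u ≤ L * (1 - ‖x‖) * ‖u‖ := by
          refine (le_abs_self _).trans ?_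
          rw [abs_mul]
          have := hn1 x hx
          exact mul_le_mul hdist (hinner x) (abs_nonneg _)
            (mul_nonneg L.coe_nonneg (by linarith))
        have h5 := mul_le_mul_of_nonneg_left h4 (pow_nonneg hxn.le q)
        rw [pow_succ]
        nlinarith [h5]
    have h := hright.trans (hparts.symm.le.trans hleft)
    rw [← mul_sub] at h
    have h' : (q + 1 : ℝ) * (I / (q + d) - L * ‖u‖ * A / ((q + d) * (q + 1 + d))) ≤
        (q + 1) * (c * A / (d * (q + 1 + d))) := h.trans_eq (by ring)
    exact le_of_mul_le_mul_left h' hq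
  -- After clearing denominators, the error is `O(1 / q)`.
  have key2 : ∀ q : ℕ, d * I ≤ c * A + (d * (L * ‖u‖ * A) - c * A) / ((q : ℝ) + (1 + d)) := by
    intro q
    have h := key q
    have h1 : (0 : ℝ) < q + d := by positivity
    have h2 : (0 : ℝ) < q + 1 + d := by positivity
    have h3 := mul_le_mul_of_nonneg_left h (mul_pos hd0 h1).le
    have e1 : d * (q + d) * (I / (q + d) - L * ‖u‖ * A / ((q + d) * (q + 1 + d))) =
        d * I - d * (L * ‖u‖ * A) / (q + (1 + d)) := by field_simp; ring
    have e2 : d * (q + d) * (c * A / (d * (q + 1 + d))) = c * A - c * A / (q + (1 + d)) := by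
      field_simp; ring
    rw [e1, e2] at h3
    rw [sub_div]
    linarith
  have hlim : Tendsto (fun q : ℕ => c * A + (d * (L * ‖u‖ * A) - c * A) / ((q : ℝ) + (1 + d)))
      atTop (𝓝 (c * A + 0)) :=
    tendsto_const_nhds.add (Tendsto.div_atTop tendsto_const_nhds
      (tendsto_atTop_add_const_right _ _ tendsto_natCast_atTop_atTop))
  rw [add_zero] at hlim
  exact ge_of_tendsto' hlim key2

end Stokes

/-! ### The two-point gradient estimate -/

section Gradient

/-- The gradient inequality for convex functions. -/
theorem ConvexOn.fderiv_apply_le_sub {E : Type*} [NormedAddCommGroup E] [NormedSpace ℝ E]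
    {K : Set E} {f : E → ℝ} (hf : ConvexOn ℝ K f) {p v : E} (hp : p ∈ K) (hpv : p + v ∈ K)
    (hd : DifferentiableAt ℝ f p) : fderiv ℝ f p v ≤ f (p + v) - f p := by
  have hconv := hf.comp_affineMap (AffineMap.lineMap p (p + v) : ℝ →ᵃ[ℝ] E)
  have hderiv : HasDerivAt (f ∘ (AffineMap.lineMap p (p + v) : ℝ →ᵃ[ℝ] E)) (fderiv ℝ f p v) 0 := by
    have h1 : HasDerivAt (fun t : ℝ => p + t • v) v 0 := by
      simpa using ((hasDerivAt_id (0 : ℝ)).smul_const v).const_add p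
    have h2 : HasFDerivAt f (fderiv ℝ f p) (p + (0 : ℝ) • v) := by simpa using hd.hasFDerivAt
    refine (h2.comp_hasDerivAt (0 : ℝ) h1).congr_of_eventuallyEq (.of_forall fun t => ?_)
    simp [AffineMap.lineMap_apply, add_comm]
  have h := hconv.le_slope_of_hasDerivAt (x := 0) (y := 1) (by simpa using hp) (by simpa using hpv)
    zero_lt_one hderiv
  simpa [slope_def_field] using h

variable {d : ℕ} {K : Set (EuclideanSpace ℝ (Fin d))} {G : ℝ≥0}

theorem norm_twoPointGrad_le {ℓ : EuclideanSpace ℝ (Fin d) → ℝ} (hℓ : LipschitzOnWith G ℓ K)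
    {δ : ℝ} (hδ : 0 < δ) {x s : EuclideanSpace ℝ (Fin d)} (hs : ‖s‖ = 1)
    (hplus : x + δ • s ∈ K) (hminus : x - δ • s ∈ K) :
    ‖twoPointGrad δ ℓ x s‖ ≤ G * d := by
  have h := hℓ.dist_le_mul _ hplus _ hminus
  have h1 : dist (x + δ • s) (x - δ • s) = 2 * δ := by
    rw [dist_eq_norm, show x + δ • s - (x - δ • s) = (2 * δ) • s by module, norm_smul, hs,
      Real.norm_eq_abs, abs_of_pos (by positivity), mul_one]
  rw [h1, Real.dist_eq] at h
  rw [twoPointGrad, norm_smul, hs, mul_one, Real.norm_eq_abs, abs_mul, abs_of_nonneg (by positivity)]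
  calc _ ≤ (d : ℝ) / (2 * δ) * (G * (2 * δ)) := by gcongr
    _ = _ := by field_simp

/-- In expectation over the direction, the two-point estimate at `x` acts like a subgradient up to
the smoothing error `2Gδ`. -/
theorem sub_le_integral_inner_twoPointGrad (hd : 0 < d) {ℓ : EuclideanSpace ℝ (Fin d) → ℝ}
    (hℓ : ℓ ∈ lossClass K G) {δ : ℝ} (hδ : 0 < δ) {x y : EuclideanSpace ℝ (Fin d)}
    (hx : Metric.closedBall x δ ⊆ K) (hy : Metric.closedBall y δ ⊆ K) :
    ℓ x - ℓ y - 2 * G * δ ≤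
      ∫ s, inner ℝ (twoPointGrad δ ℓ x (s : EuclideanSpace ℝ (Fin d))) (x - y)
        ∂uniformSphere d := by
  obtain ⟨hLip, hDiff, hConv⟩ := hℓ
  have : Nonempty (Fin d) := ⟨⟨0, hd⟩⟩
  -- The values of `ℓ` off `K` are arbitrary; integration by parts needs a globally Lipschitz function.
  obtain ⟨f, hf, hfK⟩ := hLip.extend_real
  -- On the sphere, `⟪g, x - y⟫` is `-(d / δ) φ(s) ⟪s, x - y⟫`.
  set φ : EuclideanSpace ℝ (Fin d) → ℝ := fun z => (f (x - δ • z) - f (x + δ • z)) / 2 with hφ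
  have hxδ : x ∈ K := hx (Metric.mem_closedBall_self hδ.le)
  have hyδ : y ∈ K := hy (Metric.mem_closedBall_self hδ.le)
  have hfconv : ConvexOn ℝ K f := hConv.congr hfK
  have hφLip : LipschitzWith (G * δ.toNNReal) φ := by
    refine LipschitzWith.of_dist_le_mul fun a b => ?_
    have h1 := hf.dist_le_mul (x - δ • a) (x - δ • b)
    have h2 := hf.dist_le_mul (x + δ • a) (x + δ • b)
    rw [dist_sub_left, dist_smul₀, Real.norm_eq_abs, abs_of_pos hδ, Real.dist_eq] at h1
    rw [dist_add_left, dist_smul₀, Real.norm_eq_abs, abs_of_pos hδ, Real.dist_eq] at h2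
    rw [Real.dist_eq, NNReal.coe_mul, Real.coe_toNNReal _ hδ.le, hφ]
    rw [abs_le] at h1 h2 ⊢
    constructor <;> linarith
  -- At a point `x + w` in the open ball, convexity bounds the derivative towards `y + w`.
  have hdir : ∀ w : EuclideanSpace ℝ (Fin d), ‖w‖ < δ → DifferentiableAt ℝ f (x + w) ∧
      fderiv ℝ f (x + w) (y - x) ≤ ℓ y - ℓ x + 2 * G * δ := by
    intro w hw
    have hmem : x + w ∈ K := hx (by simpa using hw.le)
    have hmemy : y + w ∈ K := hy (by simpa using hw.le)
    have hnhds : K ∈ 𝓝 (x + w) :=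
      mem_of_superset (Metric.isOpen_ball.mem_nhds (by simpa using hw : x + w ∈ Metric.ball x δ))
        (Metric.ball_subset_closedBall.trans hx)
    have hdiff : DifferentiableAt ℝ f (x + w) :=
      ((hDiff _ hmem).differentiableAt hnhds).congr_of_eventuallyEq
        (by filter_upwards [hnhds] with z hz using (hfK hz).symm)
    refine ⟨hdiff, ?_⟩
    have e : x + w + (y - x) = y + w := by abel
    have h := hfconv.fderiv_apply_le_sub hmem (v := y - x) (by rwa [e]) hdiff
    rw [e, ← hfK hmemy, ← hfK hmem] at h
    have h1 := hLip.dist_le_mul _ hmemy _ hyδ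
    have h2 := hLip.dist_le_mul _ hmem _ hxδ
    rw [dist_self_add_left, Real.dist_eq] at h1 h2
    have h3 : (G : ℝ) * ‖w‖ ≤ G * δ := by gcongr
    rw [abs_le] at h1 h2
    linarith
  have hc : ∀ z ∈ Metric.ball (0 : EuclideanSpace ℝ (Fin d)) 1,
      lineDeriv ℝ φ z (x - y) ≤ δ * (ℓ y - ℓ x + 2 * G * δ) := by
    intro z hz
    have hz1 : ‖δ • z‖ < δ := by
      rw [norm_smul, Real.norm_eq_abs, abs_of_pos hδ]
      have : ‖z‖ < 1 := by simpa using hz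
      nlinarith
    obtain ⟨hdp, hbp⟩ := hdir (δ • z) hz1
    obtain ⟨hdm, hbm⟩ := hdir (-(δ • z)) (by rwa [norm_neg])
    rw [← sub_eq_add_neg] at hdm hbm
    have hderiv : HasFDerivAt φ
        ((1 / 2 : ℝ) • ((fderiv ℝ f (x - δ • z)).comp (-(δ • ContinuousLinearMap.id ℝ _)) -
          (fderiv ℝ f (x + δ • z)).comp (δ • ContinuousLinearMap.id ℝ _))) z := by
      have hs : HasFDerivAt (fun z : EuclideanSpace ℝ (Fin d) => δ • z)
          (δ • ContinuousLinearMap.id ℝ _) z := (hasFDerivAt_id z).const_smul δ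
      have h1 := HasFDerivAt.comp z hdm.hasFDerivAt (hs.const_sub x)
      have h2 := HasFDerivAt.comp z hdp.hasFDerivAt (hs.const_add x)
      refine ((h1.sub h2).const_smul (1 / 2 : ℝ)).congr_of_eventuallyEq (.of_forall fun z => ?_)
      simp [hφ]
      ring
    have hval := (hderiv.hasLineDerivAt (x - y)).lineDeriv
    rw [hval, ← neg_sub y x]
    rw [map_sub] at hbp hbm
    simp
    linarith [mul_le_mul_of_nonneg_left hbp hδ.le, mul_le_mul_of_nonneg_left hbm hδ.le]
  have hmain := finrank_mul_integral_sphere_inner_le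
    (volume : Measure (EuclideanSpace ℝ (Fin d))) hφLip (x - y) hc
  rw [finrank_euclideanSpace, Fintype.card_fin] at hmain
  set ν := (volume : Measure (EuclideanSpace ℝ (Fin d))).toSphere with hν
  have hA : 0 < ν.real Set.univ := by
    rw [measureReal_def]
    exact ENNReal.toReal_pos (Measure.measure_univ_ne_zero.2 (Measure.toSphere_ne_zero _)) (measure_ne_top _ _)
  have hint : ∫ s, inner ℝ (twoPointGrad δ ℓ x (s : EuclideanSpace ℝ (Fin d))) (x - y)
      ∂uniformSphere d =
      -((ν.real Set.univ)⁻¹ * (δ⁻¹ * (d * ∫ s, φ (s : EuclideanSpace ℝ (Fin d)) *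
        inner ℝ (s : EuclideanSpace ℝ (Fin d)) (x - y) ∂ν))) := by
    rw [uniformSphere, ← hν, integral_smul_measure, ENNReal.toReal_inv, ← measureReal_def,
      smul_eq_mul, ← mul_neg]
    congr 1
    rw [← integral_const_mul, ← integral_const_mul, ← integral_neg]
    refine integral_congr_ae (.of_forall fun s => ?_)
    have hs : ‖(s : EuclideanSpace ℝ (Fin d))‖ = 1 := by simp
    have hsδ : ‖δ • (s : EuclideanSpace ℝ (Fin d))‖ = δ := by
      rw [norm_smul, hs, Real.norm_eq_abs, abs_of_pos hδ, mul_one]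
    have hp : x + δ • (s : EuclideanSpace ℝ (Fin d)) ∈ K := hx (by simp [hsδ])
    have hm : x - δ • (s : EuclideanSpace ℝ (Fin d)) ∈ K := hx (by simp [hsδ])
    simp only [twoPointGrad, real_inner_smul_left, hφ]
    rw [hfK hp, hfK hm]
    field_simp
    ring
  rw [hint]
  have h1 : (ν.real Set.univ)⁻¹ * (δ⁻¹ * (d * ∫ s, φ (s : EuclideanSpace ℝ (Fin d)) *
        inner ℝ (s : EuclideanSpace ℝ (Fin d)) (x - y) ∂ν)) ≤
      (ν.real Set.univ)⁻¹ * (δ⁻¹ * (δ * (ℓ y - ℓ x + 2 * G * δ) * ν.real Set.univ)) := by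
    gcongr
  have h2 : (ν.real Set.univ)⁻¹ * (δ⁻¹ * (δ * (ℓ y - ℓ x + 2 * G * δ) * ν.real Set.univ)) =
      ℓ y - ℓ x + 2 * G * δ := by
    field_simp
  linarith

end Gradient

/-! ### Projected gradient descent -/

section Descent

variable {d : ℕ} {C : Set (EuclideanSpace ℝ (Fin d))}

/-- The variational inequality that characterizes the projection. -/
theorem inner_sub_euclProj_le_zero (hC : IsClosed C) (hconv : Convex ℝ C)
    (z : EuclideanSpace ℝ (Fin d)) {w : EuclideanSpace ℝ (Fin d)} (hw : w ∈ C) :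
    inner ℝ (z - euclProj C z) (w - euclProj C z) ≤ 0 := by
  obtain ⟨hmem, hmin⟩ := euclProj_spec hC ⟨w, hw⟩ z
  refine (norm_eq_iInf_iff_real_inner_le_zero hconv hmem).1 ?_ w hw
  have : Nonempty C := ⟨⟨w, hw⟩⟩
  refine le_antisymm (le_ciInf fun v => ?_)
    (ciInf_le ⟨0, by rintro _ ⟨v, rfl⟩; exact norm_nonneg _⟩ (⟨_, hmem⟩ : C))
  rw [norm_sub_rev, norm_sub_rev z v]
  exact hmin v.2

theorem lipschitzWith_euclProj (hC : IsClosed C) (hconv : Convex ℝ C) (hne : C.Nonempty) :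
    LipschitzWith 1 (euclProj C) := by
  refine LipschitzWith.of_dist_le_mul fun z w => ?_
  rw [NNReal.coe_one, one_mul, dist_eq_norm, dist_eq_norm]
  have h1 := inner_sub_euclProj_le_zero hC hconv z (euclProj_spec hC hne w).1
  have h2 := inner_sub_euclProj_le_zero hC hconv w (euclProj_spec hC hne z).1
  set p := euclProj C z
  set q := euclProj C w
  have h3 : ‖p - q‖ ^ 2 ≤ inner ℝ (z - w) (p - q) := by
    have e : inner ℝ (z - w) (p - q) =
        ‖p - q‖ ^ 2 - inner ℝ (z - p) (q - p) - inner ℝ (w - q) (p - q) := by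
      rw [← real_inner_self_eq_norm_sq, ← neg_sub p q, inner_neg_right, sub_neg_eq_add,
        ← inner_add_left, ← inner_sub_left]
      congr 1
      abel
    linarith
  have h4 := real_inner_le_norm (z - w) (p - q)
  by_contra! h
  nlinarith [norm_nonneg (z - w)]

theorem euclProj_of_mem (hC : IsClosed C) {y : EuclideanSpace ℝ (Fin d)} (hy : y ∈ C) :
    euclProj C y = y := by
  have h := (euclProj_spec hC ⟨y, hy⟩ y).2 hy
  simpa [sub_eq_zero] using h

theorem osgd_mem (hC : IsClosed C) (h0 : 0 ∈ C) (η : ℝ)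
    (g : ℕ → EuclideanSpace ℝ (Fin d) → EuclideanSpace ℝ (Fin d)) (t : ℕ) :
    osgd C η g t ∈ C := by
  cases t with
  | zero => exact h0
  | succ t => exact (euclProj_spec hC ⟨0, h0⟩ _).1

/-- The regret of projected gradient descent started at `0`, along a fixed sequence of estimates,
from telescoping `‖x_t - y‖²`. -/
theorem sum_inner_osgd_le (hC : IsClosed C) (hconv : Convex ℝ C) {η : ℝ} (hη : 0 < η)
    (g : ℕ → EuclideanSpace ℝ (Fin d) → EuclideanSpace ℝ (Fin d))
    {y : EuclideanSpace ℝ (Fin d)} (hy : y ∈ C) {M : ℝ} (n : ℕ)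
    (hM : ∀ t < n, ‖g t (osgd C η g t)‖ ≤ M) :
    ∑ t ∈ Finset.range n, inner ℝ (g t (osgd C η g t)) (osgd C η g t - y) ≤
      ‖y‖ ^ 2 / (2 * η) + η / 2 * M ^ 2 * n := by
  have key : 2 * η * ∑ t ∈ Finset.range n, inner ℝ (g t (osgd C η g t)) (osgd C η g t - y) +
      ‖osgd C η g n - y‖ ^ 2 ≤ ‖y‖ ^ 2 + η ^ 2 * M ^ 2 * n := by
    induction n with
    | zero => simp [osgd]
    | succ n ih =>
      specialize ih fun t ht => hM t (ht.trans n.lt_succ_self)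
      have hg := hM n n.lt_succ_self
      rw [Finset.sum_range_succ, osgd]
      set x := osgd C η g n
      have h1 := (lipschitzWith_euclProj hC hconv ⟨y, hy⟩).dist_le_mul (x - η • g n x) y
      rw [euclProj_of_mem hC hy, NNReal.coe_one, one_mul, dist_eq_norm, dist_eq_norm] at h1
      have h2 : ‖x - η • g n x - y‖ ^ 2 =
          ‖x - y‖ ^ 2 - 2 * η * inner ℝ (g n x) (x - y) + η ^ 2 * ‖g n x‖ ^ 2 := by
        rw [sub_right_comm, norm_sub_sq_real, norm_smul, inner_smul_right, real_inner_comm,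
          mul_pow, Real.norm_eq_abs, sq_abs]
        ring
      have h3 : ‖euclProj C (x - η • g n x) - y‖ ^ 2 ≤ ‖x - η • g n x - y‖ ^ 2 := by gcongr
      have h4 : η ^ 2 * ‖g n x‖ ^ 2 ≤ η ^ 2 * M ^ 2 := by gcongr
      push_cast
      linarith
  have e : ‖y‖ ^ 2 / (2 * η) + η / 2 * M ^ 2 * n =
      (‖y‖ ^ 2 + η ^ 2 * M ^ 2 * n) / (2 * η) := by field_simp
  rw [e, le_div_iff₀ (by positivity)]
  nlinarith [sq_nonneg ‖osgd C η g n - y‖]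

/-- Shrinking `K` by the factor `1 - δ / r` leaves a margin of width `δ`, since
`(1 - δ/r) K + (δ/r) K ⊆ K` and `K` contains the ball of radius `r`. -/
theorem closedBall_subset_of_mem_shrink {K : Set (EuclideanSpace ℝ (Fin d))} {r δ : ℝ} (hr : 0 < r)
    (hK : Convex ℝ K) (hrK : Metric.closedBall 0 r ⊆ K) (hδ : 0 ≤ δ) (hδr : δ ≤ r)
    {x : EuclideanSpace ℝ (Fin d)} (hx : x ∈ (1 - δ / r) • K) : Metric.closedBall x δ ⊆ K := by
  intro z hz
  obtain ⟨k, hk, rfl⟩ := hx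
  rcases hδ.eq_or_lt with rfl | hδ
  · have : z = k := by simpa using hz
    exact this ▸ hk
  have hmem : (r / δ) • (z - (1 - δ / r) • k) ∈ K := by
    refine hrK ?_
    rw [mem_closedBall_zero_iff, norm_smul, Real.norm_eq_abs, abs_of_pos (by positivity)]
    rw [mem_closedBall_iff_norm] at hz
    calc r / δ * _ ≤ r / δ * δ := by gcongr
      _ = r := by field_simp
  have h := hK hk hmem (sub_nonneg.2 ((div_le_one hr).2 hδr)) (by positivity : 0 ≤ δ / r) (by ring)
  rw [smul_smul, show δ / r * (r / δ) = 1 by field_simp, one_smul, add_sub_cancel] at h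
  exact h

end Descent

/-! ### Measurability and independence -/

section Measurability

variable {d : ℕ} {K : Set (EuclideanSpace ℝ (Fin d))} {G : ℝ≥0}

/-- Carathéodory functions can be evaluated at random points: `u a x` is measurable in `a` and
continuous in `x`. -/
theorem measurable_eval_of_lipschitzOnWith {α : Type*} [MeasurableSpace α]
    {u : α → EuclideanSpace ℝ (Fin d) → ℝ} (hu : ∀ a, LipschitzOnWith G (u a) K)
    (hum : ∀ x ∈ K, Measurable fun a => u a x) {X : α → EuclideanSpace ℝ (Fin d)}
    (hX : Measurable X) (hXK : ∀ a, X a ∈ K) : Measurable fun a => u a (X a) := by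
  have h : Measurable (Function.uncurry fun (p : K) (a : α) => u a p) :=
    measurable_uncurry_of_continuous_of_measurable
      (fun a => (hu a).continuousOn.domRestrict) fun p => hum p p.2
  exact h.comp ((hX.subtype_mk (h := hXK)).prodMk measurable_id)

theorem measurable_twoPointGrad {α : Type*} [MeasurableSpace α]
    {u : α → EuclideanSpace ℝ (Fin d) → ℝ} (hu : ∀ a, LipschitzOnWith G (u a) K)
    (hum : ∀ x ∈ K, Measurable fun a => u a x) {X s : α → EuclideanSpace ℝ (Fin d)}
    (hX : Measurable X) (hs : Measurable s) {δ : ℝ} (hplus : ∀ a, X a + δ • s a ∈ K)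
    (hminus : ∀ a, X a - δ • s a ∈ K) :
    Measurable fun a => twoPointGrad δ (u a) (X a) (s a) := by
  have h1 := measurable_eval_of_lipschitzOnWith hu hum (hX.add (hs.const_smul δ)) hplus
  have h2 := measurable_eval_of_lipschitzOnWith hu hum (hX.sub (hs.const_smul δ)) hminus
  exact ((h1.sub h2).const_mul _).smul hs

theorem isProbabilityMeasure_uniformSphere (hd : 0 < d) :
    IsProbabilityMeasure (uniformSphere d) := by
  have : Nonempty (Fin d) := ⟨⟨0, hd⟩⟩
  refine ⟨?_⟩
  rw [uniformSphere, Measure.smul_apply, smul_eq_mul]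
  exact ENNReal.inv_mul_cancel
    (Measure.measure_univ_ne_zero.2 (Measure.toSphere_ne_zero _)) (measure_ne_top _ _)

/-- For independent `X` and `Y`, the expectation of `H (X, Y)` may be taken over `Y` first. -/
theorem ProbabilityTheory.IndepFun.integral_comp_prodMk {Ω α β : Type*} [MeasurableSpace Ω]
    [MeasurableSpace α] [MeasurableSpace β] {P : Measure Ω} [IsFiniteMeasure P] {X : Ω → α}
    {Y : Ω → β} (h : IndepFun X Y P) (hX : Measurable X) (hY : Measurable Y) {H : α × β → ℝ}
    (hH : Measurable H) {M : ℝ} (hM : ∀ z, |H z| ≤ M) :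
    Integrable (fun ω => ∫ b, H (X ω, b) ∂P.map Y) P ∧
      ∫ ω, H (X ω, Y ω) ∂P = ∫ ω, ∫ b, H (X ω, b) ∂P.map Y ∂P := by
  have hmap := (indepFun_iff_map_prod_eq_prod_map_map hX.aemeasurable hY.aemeasurable).1 h
  have hint : Integrable H ((P.map X).prod (P.map Y)) :=
    Integrable.of_bound hH.aestronglyMeasurable M (.of_forall hM)
  have hleft := hint.integral_prod_left
  refine ⟨hleft.comp_measurable hX, ?_⟩
  rw [← integral_map (f := H) (hX.prodMk hY).aemeasurable hH.aestronglyMeasurable, hmap,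
    integral_prod _ hint, integral_map hX.aemeasurable hleft.aestronglyMeasurable]

end Measurability

/-! ### The two-point game -/

section Game

variable {d : ℕ} {K : Set (EuclideanSpace ℝ (Fin d))} {G : ℝ≥0} {r R δ η : ℝ}
  {Ω : Type*} {ℓ : ℕ → Ω → EuclideanSpace ℝ (Fin d) → ℝ}
  {S : ℕ → Ω → Metric.sphere (0 : EuclideanSpace ℝ (Fin d)) 1} {σ : ℕ → Ω → Bool}

theorem zero_mem_shrink (hr : 0 < r) (hrK : Metric.closedBall 0 r ⊆ K) :
    (0 : EuclideanSpace ℝ (Fin d)) ∈ (1 - δ / r) • K :=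
  ⟨0, hrK (Metric.mem_closedBall_self hr.le), smul_zero _⟩

theorem osgdIterate_mem (hr : 0 < r) (hK : IsCompact K) (hrK : Metric.closedBall 0 r ⊆ K)
    (t : ℕ) (ω : Ω) : osgdIterate K r δ η ℓ S t ω ∈ (1 - δ / r) • K :=
  osgd_mem (hK.smul _).isClosed (zero_mem_shrink hr hrK) _ _ _

theorem closedBall_osgdIterate_subset (hr : 0 < r) (hK : IsCompact K) (hconv : Convex ℝ K)
    (hrK : Metric.closedBall 0 r ⊆ K) (hδ : 0 ≤ δ) (hδr : δ ≤ r) (t : ℕ) (ω : Ω) :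
    Metric.closedBall (osgdIterate K r δ η ℓ S t ω) δ ⊆ K :=
  closedBall_subset_of_mem_shrink hr hconv hrK hδ hδr (osgdIterate_mem hr hK hrK t ω)

theorem norm_smul_sphere (hδ : 0 ≤ δ) (s : Metric.sphere (0 : EuclideanSpace ℝ (Fin d)) 1) :
    ‖δ • (s : EuclideanSpace ℝ (Fin d))‖ = δ := by
  rw [norm_smul, norm_eq_of_mem_sphere, mul_one, Real.norm_eq_abs, abs_of_nonneg hδ]

theorem add_smul_sphere_mem {x : EuclideanSpace ℝ (Fin d)} (hδ : 0 ≤ δ)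
    (hx : Metric.closedBall x δ ⊆ K) (s : Metric.sphere (0 : EuclideanSpace ℝ (Fin d)) 1) :
    x + δ • (s : EuclideanSpace ℝ (Fin d)) ∈ K :=
  hx (by simpa using (norm_smul_sphere hδ s).le)

theorem sub_smul_sphere_mem {x : EuclideanSpace ℝ (Fin d)} (hδ : 0 ≤ δ)
    (hx : Metric.closedBall x δ ⊆ K) (s : Metric.sphere (0 : EuclideanSpace ℝ (Fin d)) 1) :
    x - δ • (s : EuclideanSpace ℝ (Fin d)) ∈ K :=
  hx (by simpa using (norm_smul_sphere hδ s).le)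

theorem queryPlus_mem (hr : 0 < r) (hK : IsCompact K) (hconv : Convex ℝ K)
    (hrK : Metric.closedBall 0 r ⊆ K) (hδ : 0 ≤ δ) (hδr : δ ≤ r) (t : ℕ) (ω : Ω) :
    queryPlus K r δ η ℓ S t ω ∈ K :=
  add_smul_sphere_mem hδ (closedBall_osgdIterate_subset hr hK hconv hrK hδ hδr t ω) _

theorem queryMinus_mem (hr : 0 < r) (hK : IsCompact K) (hconv : Convex ℝ K)
    (hrK : Metric.closedBall 0 r ⊆ K) (hδ : 0 ≤ δ) (hδr : δ ≤ r) (t : ℕ) (ω : Ω) :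
    queryMinus K r δ η ℓ S t ω ∈ K :=
  sub_smul_sphere_mem hδ (closedBall_osgdIterate_subset hr hK hconv hrK hδ hδr t ω) _

theorem played_mem (hr : 0 < r) (hK : IsCompact K) (hconv : Convex ℝ K)
    (hrK : Metric.closedBall 0 r ⊆ K) (hδ : 0 ≤ δ) (hδr : δ ≤ r) (t : ℕ) (ω : Ω) :
    played K r δ η ℓ S σ t ω ∈ K := by
  rw [played]
  split_ifs
  exacts [queryPlus_mem hr hK hconv hrK hδ hδr t ω, queryMinus_mem hr hK hconv hrK hδ hδr t ω]

theorem dist_played_osgdIterate (hδ : 0 ≤ δ) (t : ℕ) (ω : Ω) :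
    dist (played K r δ η ℓ S σ t ω) (osgdIterate K r δ η ℓ S t ω) = δ := by
  rw [played]
  split_ifs
  · rw [queryPlus, dist_self_add_left, norm_smul_sphere hδ]
  · rw [queryMinus, dist_eq_norm, sub_sub_cancel_left, norm_neg, norm_smul_sphere hδ]

variable [mΩ : MeasurableSpace Ω] {P : Measure Ω} {ℱ : Filtration ℕ mΩ}

/-- In dimension `0` the unit sphere is empty, so there are no random directions. -/
theorem dim_pos_of_sphere (hP : P ≠ 0) (S : ℕ → Ω → Metric.sphere (0 : EuclideanSpace ℝ (Fin d)) 1) :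
    0 < d := by
  rcases Nat.eq_zero_or_pos d with rfl | h
  · have : Nonempty Ω := by
      by_contra h
      rw [not_nonempty_iff] at h
      exact hP P.eq_zero_of_isEmpty
    obtain ⟨ω⟩ := this
    have h1 : ‖(S 0 ω : EuclideanSpace ℝ (Fin 0))‖ = 1 := by simp
    rw [Subsingleton.elim (S 0 ω : EuclideanSpace ℝ (Fin 0)) 0, norm_zero] at h1
    exact absurd h1 zero_ne_one
  · exact h

theorem IsTwoPointGame.measurable_osgdIterate (h : IsTwoPointGame K G P ℱ ℓ S σ)
    (hr : 0 < r) (hK : IsCompact K) (hconv : Convex ℝ K) (hrK : Metric.closedBall 0 r ⊆ K)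
    (hδ : 0 ≤ δ) (hδr : δ ≤ r) (t : ℕ) :
    Measurable[ℱ t] (osgdIterate K r δ η ℓ S t) := by
  induction t with
  | zero => exact measurable_const
  | succ t ih =>
    have hx : Measurable[ℱ (t + 1)] (osgdIterate K r δ η ℓ S t) :=
      ih.mono (ℱ.mono t.le_succ) le_rfl
    have hball := closedBall_osgdIterate_subset (η := η) (ℓ := ℓ) (S := S) hr hK hconv hrK hδ hδr t
    have hg := @measurable_twoPointGrad d K G Ω (ℱ (t + 1)) (ℓ t) (fun ω => (h.loss_mem t ω).1)
      (fun x hx => (h.loss_measurable t x hx).mono (ℱ.mono t.le_succ) le_rfl) _ _ hx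
      (measurable_subtype_coe.comp (h.dir_measurable t)) δ
      (fun ω => add_smul_sphere_mem hδ (hball ω) _) (fun ω => sub_smul_sphere_mem hδ (hball ω) _)
    exact (lipschitzWith_euclProj (hK.smul (1 - δ / r)).isClosed (hconv.smul _)
      ⟨0, zero_mem_shrink hr hrK⟩).continuous.measurable.comp (hx.sub (hg.const_smul η))

theorem IsTwoPointGame.integrable_loss_comp [IsFiniteMeasure P]
    (h : IsTwoPointGame K G P ℱ ℓ S σ)
    (h0 : 0 ∈ K) (hKR : K ⊆ Metric.closedBall 0 R) (t : ℕ) {X : Ω → EuclideanSpace ℝ (Fin d)}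
    (hX : Measurable X) (hXK : ∀ ω, X ω ∈ K) : Integrable (fun ω => ℓ t ω (X ω)) P := by
  have hm := measurable_eval_of_lipschitzOnWith (fun ω => (h.loss_mem t ω).1)
    (fun x hx => (h.loss_measurable t x hx).mono (ℱ.le t) le_rfl) hX hXK
  have hm0 := (h.loss_measurable t 0 h0).mono (ℱ.le t) le_rfl
  have hdiff : Integrable (fun ω => ℓ t ω (X ω) - ℓ t ω 0) P := by
    refine Integrable.of_bound (hm.sub hm0).aestronglyMeasurable (G * R) (.of_forall fun ω => ?_)
    have h1 := (h.loss_mem t ω).1.dist_le_mul _ (hXK ω) _ h0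
    have h2 : dist (X ω) 0 ≤ R := hKR (hXK ω)
    rw [Real.dist_eq] at h1
    exact h1.trans (by gcongr)
  refine (hdiff.add (h.loss_integrable t 0 h0)).congr (.of_forall fun ω => ?_)
  simp

theorem IsTwoPointGame.map_dir (h : IsTwoPointGame K G P ℱ ℓ S σ) (hd : 0 < d) (t : ℕ) :
    P.map (S t) = uniformSphere d := by
  have := isProbabilityMeasure_uniformSphere hd
  have hS : Measurable (S t) := (h.dir_measurable t).mono (ℱ.le _) le_rfl
  have hσ : Measurable (σ t) := (h.coin_measurable t).mono (ℱ.le _) le_rfl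
  have h1 := congrArg (Measure.map Prod.fst) (h.draw_law t)
  rw [Measure.map_map measurable_fst (hS.prodMk hσ), Measure.map_fst_prod, measure_univ,
    one_smul] at h1
  exact h1

/-- The expected version of `sub_le_integral_inner_twoPointGrad` in round `t`, where the loss and
the iterate are random but independent of the direction. -/
theorem IsTwoPointGame.integral_loss_sub_le [IsProbabilityMeasure P]
    (h : IsTwoPointGame K G P ℱ ℓ S σ) (hr : 0 < r) (hconv : Convex ℝ K)
    (hK : IsCompact K) (hrK : Metric.closedBall 0 r ⊆ K) (hKR : K ⊆ Metric.closedBall 0 R)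
    (hδ : 0 < δ) (hδr : δ ≤ r) {y : EuclideanSpace ℝ (Fin d)} (hy : y ∈ (1 - δ / r) • K) (t : ℕ) :
    Integrable (fun ω => inner ℝ (twoPointGrad δ (ℓ t ω) (osgdIterate K r δ η ℓ S t ω) (S t ω))
        (osgdIterate K r δ η ℓ S t ω - y)) P ∧
      ∫ ω, (ℓ t ω (osgdIterate K r δ η ℓ S t ω) - ℓ t ω y - 2 * G * δ) ∂P ≤
        ∫ ω, inner ℝ (twoPointGrad δ (ℓ t ω) (osgdIterate K r δ η ℓ S t ω) (S t ω))
          (osgdIterate K r δ η ℓ S t ω - y) ∂P := by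
  have hd : 0 < d := dim_pos_of_sphere (IsProbabilityMeasure.ne_zero P) S
  set x := osgdIterate K r δ η ℓ S t with hxdef
  have hball : ∀ ω, Metric.closedBall (x ω) δ ⊆ K :=
    closedBall_osgdIterate_subset hr hK hconv hrK hδ.le hδr t
  have hyball := closedBall_subset_of_mem_shrink hr hconv hrK hδ.le hδr hy
  have hx : Measurable[ℱ t] x := h.measurable_osgdIterate hr hK hconv hrK hδ.le hδr t
  have hxm : Measurable x := hx.mono (ℱ.le t) le_rfl
  have hyK : y ∈ K := hyball (Metric.mem_closedBall_self hδ.le)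
  have hxK : ∀ ω, x ω ∈ K := fun ω => hball ω (Metric.mem_closedBall_self hδ.le)
  have h0 : (0 : EuclideanSpace ℝ (Fin d)) ∈ K := hrK (Metric.mem_closedBall_self hr.le)
  have hS : Measurable (S t) := (h.dir_measurable t).mono (ℱ.le _) le_rfl
  set H : Ω × Metric.sphere (0 : EuclideanSpace ℝ (Fin d)) 1 → ℝ := fun z =>
    inner ℝ (twoPointGrad δ (ℓ t z.1) (x z.1) z.2) (x z.1 - y) with hHdef
  have hH : Measurable[(ℱ t).prod inferInstance] H := by
    have hfst : Measurable[(ℱ t).prod inferInstance, ℱ t]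
      (Prod.fst : Ω × Metric.sphere (0 : EuclideanSpace ℝ (Fin d)) 1 → Ω) := @measurable_fst _ _ (ℱ t) _
    have hsnd : Measurable[(ℱ t).prod inferInstance]
      (Prod.snd : Ω × Metric.sphere (0 : EuclideanSpace ℝ (Fin d)) 1 → _) :=
        @measurable_snd _ _ (ℱ t) _
    have hx' := hx.comp hfst
    have hg := @measurable_twoPointGrad d K G _ ((ℱ t).prod inferInstance) (fun z => ℓ t z.1)
      (fun z => (h.loss_mem t z.1).1) (fun p hp => (h.loss_measurable t p hp).comp hfst) _ _ hx'
      (measurable_subtype_coe.comp hsnd) δ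
      (fun z => add_smul_sphere_mem hδ.le (hball z.1) _)
      (fun z => sub_smul_sphere_mem hδ.le (hball z.1) _)
    exact hg.inner (hx'.sub measurable_const)
  have hbound : ∀ z, |H z| ≤ G * d * (2 * R) := by
    intro z
    refine (abs_real_inner_le_norm _ _).trans ?_
    have h1 := norm_twoPointGrad_le (h.loss_mem t z.1).1 hδ (norm_eq_of_mem_sphere z.2)
      (add_smul_sphere_mem hδ.le (hball z.1) _) (sub_smul_sphere_mem hδ.le (hball z.1) _)
    have h2 : ‖x z.1 - y‖ ≤ 2 * R := by
      have a : ‖x z.1‖ ≤ R := mem_closedBall_zero_iff.1 (hKR (hxK z.1))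
      have b : ‖y‖ ≤ R := mem_closedBall_zero_iff.1 (hKR hyK)
      linarith [norm_sub_le (x z.1) y]
    gcongr
  have hindep : Indep (ℱ t) (MeasurableSpace.comap (S t) inferInstance) P := by
    refine (indep_of_indep_of_le_left (h.draw_indep t) ?_).symm
    have : S t = Prod.fst ∘ fun ω => (S t ω, σ t ω) := rfl
    rw [this, ← MeasurableSpace.comap_comp]
    exact MeasurableSpace.comap_mono measurable_fst.comap_le
  -- `ℱ t` enters as the σ-algebra on the codomain of `id : Ω → Ω`.
  have hindepFun : @IndepFun Ω Ω _ mΩ (ℱ t) inferInstance id (S t) P := by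
    refine (@IndepFun_iff_Indep Ω Ω _ mΩ (ℱ t) _ id (S t) P).2 ?_
    rwa [MeasurableSpace.comap_id]
  obtain ⟨hi, he⟩ := @IndepFun.integral_comp_prodMk Ω Ω _ mΩ (ℱ t) inferInstance P _ id (S t)
    hindepFun (measurable_id'' (ℱ.le t)) hS H hH _ hbound
  rw [h.map_dir hd t] at hi he
  simp only [id] at hi he
  refine ⟨?_, ?_⟩
  · have hm : Measurable fun ω => H (ω, S t ω) :=
      hH.comp (@Measurable.prodMk Ω mΩ Ω _ (ℱ t) _ id (S t) (measurable_id'' (ℱ.le t)) hS)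
    exact Integrable.of_bound hm.aestronglyMeasurable _ (.of_forall fun ω => hbound (ω, S t ω))
  · refine le_trans (integral_mono ?_ hi fun ω => ?_) he.ge
    · exact ((h.integrable_loss_comp h0 hKR t hxm hxK).sub
        (h.loss_integrable t y hyK)).sub (integrable_const _)
    · exact sub_le_integral_inner_twoPointGrad hd (h.loss_mem t ω) hδ (hball ω) hyball

theorem IsTwoPointGame.integrable_loss_played [IsFiniteMeasure P]
    (h : IsTwoPointGame K G P ℱ ℓ S σ) (hr : 0 < r) (hK : IsCompact K) (hconv : Convex ℝ K)
    (hrK : Metric.closedBall 0 r ⊆ K) (hKR : K ⊆ Metric.closedBall 0 R) (hδ : 0 ≤ δ) (hδr : δ ≤ r)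
    (t : ℕ) : Integrable (fun ω => ℓ t ω (played K r δ η ℓ S σ t ω)) P := by
  refine h.integrable_loss_comp (hrK (Metric.mem_closedBall_self hr.le)) hKR t ?_
    (played_mem hr hK hconv hrK hδ hδr t)
  have hx : Measurable (osgdIterate K r δ η ℓ S t) :=
    (h.measurable_osgdIterate hr hK hconv hrK hδ hδr t).mono (ℱ.le t) le_rfl
  have hS : Measurable (S t) := (h.dir_measurable t).mono (ℱ.le _) le_rfl
  have hσ : Measurable (σ t) := (h.coin_measurable t).mono (ℱ.le _) le_rfl
  have hδS := (measurable_subtype_coe.comp hS).const_smul δ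
  exact Measurable.ite (hσ (measurableSet_singleton true)) (hx.add hδS) (hx.sub hδS)

theorem IsTwoPointGame.exists_isMinOn [IsProbabilityMeasure P]
    (h : IsTwoPointGame K G P ℱ ℓ S σ) (hK : IsCompact K) (hne : K.Nonempty) (n : ℕ) :
    ∃ x ∈ K, IsMinOn (fun y => ∫ ω, ∑ t ∈ Finset.range n, ℓ t ω y ∂P) K x := by
  refine hK.exists_isMinOn hne (LipschitzOnWith.continuousOn (K := n * G) ?_)
  refine LipschitzOnWith.of_dist_le_mul fun x hx y hy => ?_
  have hi : ∀ z ∈ K, Integrable (fun ω => ∑ t ∈ Finset.range n, ℓ t ω z) P := fun z hz =>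
    integrable_finsetSum _ fun t _ => h.loss_integrable t z hz
  rw [dist_eq_norm, ← integral_sub (hi x hx) (hi y hy)]
  refine (norm_integral_le_of_norm_le_const (C := n * G * dist x y) (.of_forall fun ω => ?_)).trans
    (by simp)
  rw [← Finset.sum_sub_distrib]
  refine (norm_sum_le_of_le _ fun t _ => (h.loss_mem t ω).1.dist_le_mul x hx y hy).trans ?_
  simp [mul_assoc]

/-- The regret against a fixed comparator `y ∈ K`, which is compared through its shrunk copy
`(1 - δ/r) y`. -/
theorem IsTwoPointGame.integral_sub_integral_le [IsProbabilityMeasure P]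
    (h : IsTwoPointGame K G P ℱ ℓ S σ) (hr : 0 < r) (hK : IsCompact K)
    (hconv : Convex ℝ K) (hrK : Metric.closedBall 0 r ⊆ K) (hKR : K ⊆ Metric.closedBall 0 R)
    (hδ : 0 < δ) (hδr : δ ≤ r) (hη : 0 < η) (n : ℕ) {y : EuclideanSpace ℝ (Fin d)} (hy : y ∈ K) :
    ∫ ω, ∑ t ∈ Finset.range n, ℓ t ω (played K r δ η ℓ S σ t ω) ∂P -
        ∫ ω, ∑ t ∈ Finset.range n, ℓ t ω y ∂P ≤
      R ^ 2 / (2 * η) + η / 2 * ((G : ℝ) * d) ^ 2 * n + δ * (3 + R / r) * G * n := by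
  have h0 : (0 : EuclideanSpace ℝ (Fin d)) ∈ K := hrK (Metric.mem_closedBall_self hr.le)
  have hyR : ‖y‖ ≤ R := mem_closedBall_zero_iff.1 (hKR hy)
  set y' := (1 - δ / r) • y with hy'def
  have hy' : y' ∈ (1 - δ / r) • K := ⟨y, hy, rfl⟩
  have hy'K : y' ∈ K := closedBall_subset_of_mem_shrink hr hconv hrK hδ.le hδr hy'
    (Metric.mem_closedBall_self hδ.le)
  have hyy' : dist y' y ≤ δ / r * R := by
    rw [dist_eq_norm, hy'def, sub_smul, one_smul, sub_sub_cancel_left, norm_neg, norm_smul,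
      Real.norm_eq_abs, abs_of_pos (by positivity)]
    gcongr
  have hy'R : ‖y'‖ ≤ R := mem_closedBall_zero_iff.1 (hKR hy'K)
  have hplayed := fun t => h.integrable_loss_played (η := η) hr hK hconv hrK hKR hδ.le hδr t
  have hround := fun t => h.integral_loss_sub_le (η := η) hr hconv hK hrK hKR hδ hδr hy' t
  set x := osgdIterate K r δ η ℓ S with hxdef
  have hxball : ∀ t ω, Metric.closedBall (x t ω) δ ⊆ K := fun t ω =>
    closedBall_osgdIterate_subset hr hK hconv hrK hδ.le hδr t ω
  have hxK : ∀ t ω, x t ω ∈ K := fun t ω => hxball t ω (Metric.mem_closedBall_self hδ.le)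
  have hxm : ∀ t, Measurable (x t) := fun t =>
    (h.measurable_osgdIterate hr hK hconv hrK hδ.le hδr t).mono (ℱ.le t) le_rfl
  have hxi := fun t => h.integrable_loss_comp h0 hKR t (hxm t) (hxK t)
  have hstep : ∀ t, ∫ ω, ℓ t ω (played K r δ η ℓ S σ t ω) ∂P - ∫ ω, ℓ t ω y ∂P ≤
      ∫ ω, inner ℝ (twoPointGrad δ (ℓ t ω) (x t ω) (S t ω)) (x t ω - y') ∂P +
        δ * (3 + R / r) * G := by
    intro t
    have hsub : Integrable (fun ω => ℓ t ω (x t ω) - ℓ t ω y' - 2 * G * δ) P :=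
      ((hxi t).sub (h.loss_integrable t y' hy'K)).sub (integrable_const _)
    rw [← integral_sub (hplayed t) (h.loss_integrable t y hy)]
    have h1 : ∫ ω, (ℓ t ω (played K r δ η ℓ S σ t ω) - ℓ t ω y) ∂P ≤
        ∫ ω, (ℓ t ω (x t ω) - ℓ t ω y' - 2 * G * δ + δ * (3 + R / r) * G) ∂P := by
      refine integral_mono ((hplayed t).sub (h.loss_integrable t y hy))
        (hsub.add (integrable_const _)) fun ω => ?_
      have a := (h.loss_mem t ω).1.dist_le_mul _
        (played_mem (σ := σ) (η := η) (ℓ := ℓ) (S := S) hr hK hconv hrK hδ.le hδr t ω) _ (hxK t ω)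
      rw [hxdef, dist_played_osgdIterate hδ.le, Real.dist_eq] at a
      have b := (h.loss_mem t ω).1.dist_le_mul _ hy'K _ hy
      have b' : (G : ℝ) * dist y' y ≤ G * (δ / r * R) := by gcongr
      rw [Real.dist_eq] at b
      have e : δ * (3 + R / r) * G = 3 * (G * δ) + G * (δ / r * R) := by ring
      rw [e]
      rw [abs_le] at a b
      simp only [hxdef]
      linarith [a.2, b.2]
    rw [integral_add hsub (integrable_const _)] at h1
    simp only [integral_const, probReal_univ, one_smul] at h1
    linarith [(hround t).2]
  have hdet : ∀ ω, ∑ t ∈ Finset.range n,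
      inner ℝ (twoPointGrad δ (ℓ t ω) (x t ω) (S t ω)) (x t ω - y') ≤
      R ^ 2 / (2 * η) + η / 2 * ((G : ℝ) * d) ^ 2 * n := by
    intro ω
    refine (sum_inner_osgd_le (hK.smul (1 - δ / r)).isClosed (hconv.smul _) hη
      (fun s x => twoPointGrad δ (ℓ s ω) x (S s ω)) hy' n (M := G * d) fun t _ => ?_).trans ?_
    · exact norm_twoPointGrad_le (h.loss_mem t ω).1 hδ (norm_eq_of_mem_sphere _)
        (add_smul_sphere_mem hδ.le (hxball t ω) _) (sub_smul_sphere_mem hδ.le (hxball t ω) _)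
    · gcongr
  rw [integral_finsetSum _ fun t _ => hplayed t,
    integral_finsetSum _ fun t _ => h.loss_integrable t y hy, ← Finset.sum_sub_distrib]
  calc _ ≤ ∑ t ∈ Finset.range n,
        (∫ ω, inner ℝ (twoPointGrad δ (ℓ t ω) (x t ω) (S t ω)) (x t ω - y') ∂P +
          δ * (3 + R / r) * G) := Finset.sum_le_sum fun t _ => hstep t
    _ = ∫ ω, ∑ t ∈ Finset.range n,
          inner ℝ (twoPointGrad δ (ℓ t ω) (x t ω) (S t ω)) (x t ω - y') ∂P +
        δ * (3 + R / r) * G * n := by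
      rw [Finset.sum_add_distrib, integral_finsetSum _ fun t _ => (hround t).1]
      simp [mul_comm]
    _ ≤ _ := by
      gcongr
      have := integral_mono (integrable_finsetSum _ fun t _ => (hround t).1)
        (integrable_const (μ := P) _) hdet
      simpa using this

theorem IsTwoPointGame.pseudoRegret_played_le [IsProbabilityMeasure P]
    (h : IsTwoPointGame K G P ℱ ℓ S σ) (hr : 0 < r) (hK : IsCompact K)
    (hconv : Convex ℝ K) (hrK : Metric.closedBall 0 r ⊆ K) (hKR : K ⊆ Metric.closedBall 0 R)
    (hδ : 0 < δ) (hδr : δ ≤ r) (hη : 0 < η) (n : ℕ) :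
    pseudoRegret K P ℓ (played K r δ η ℓ S σ) n ≤
      R ^ 2 / (2 * η) + η / 2 * ((G : ℝ) * d) ^ 2 * n + δ * (3 + R / r) * G * n := by
  have : Nonempty K := ⟨⟨0, hrK (Metric.mem_closedBall_self hr.le)⟩⟩
  rw [pseudoRegret, sub_le_comm]
  refine le_ciInf fun y => ?_
  rw [sub_le_comm]
  exact h.integral_sub_integral_le hr hK hconv hrK hKR hδ hδr hη n y.2

end Game

/-! ### The regret bound -/

theorem theorem6p1 {d : ℕ} (K : Set (EuclideanSpace ℝ (Fin d))) (r R : ℝ) (G : ℝ≥0)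
    (hr : 0 < r) (hR : 0 < R) (hKclosed : IsClosed K) (hKconv : Convex ℝ K)
    (hrK : Metric.closedBall 0 r ⊆ K) (hKR : K ⊆ Metric.closedBall 0 R) :
    (∀ (n : ℕ) (δ η : ℝ), 0 < δ → δ ≤ r → 0 < η →
      ∀ {Ω : Type*} [mΩ : MeasurableSpace Ω] (P : Measure Ω) [IsProbabilityMeasure P]
        (ℱ : Filtration ℕ mΩ) (ℓ : ℕ → Ω → EuclideanSpace ℝ (Fin d) → ℝ)
        (S : ℕ → Ω → Metric.sphere (0 : EuclideanSpace ℝ (Fin d)) 1) (σ : ℕ → Ω → Bool),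
        IsTwoPointGame K G P ℱ ℓ S σ →
          (∀ t ω, queryPlus K r δ η ℓ S t ω ∈ K ∧ queryMinus K r δ η ℓ S t ω ∈ K) ∧
          (∀ t, Integrable (fun ω => ℓ t ω (played K r δ η ℓ S σ t ω)) P) ∧
          (∃ x ∈ K, IsMinOn (fun y => ∫ ω, ∑ t ∈ Finset.range n, ℓ t ω y ∂P) K x) ∧
          pseudoRegret K P ℓ (played K r δ η ℓ S σ) n ≤
            R ^ 2 / η + η * ((G : ℝ) * d) ^ 2 * n + δ * (3 + R / r) * G * n) ∧
    (∀ n : ℕ, 1 ≤ n → 0 < G → ∀ ε : ℝ, 0 < ε → ∀ᶠ δ in 𝓝[>] (0 : ℝ),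
      ∀ {Ω : Type*} [mΩ : MeasurableSpace Ω] (P : Measure Ω) [IsProbabilityMeasure P]
        (ℱ : Filtration ℕ mΩ) (ℓ : ℕ → Ω → EuclideanSpace ℝ (Fin d) → ℝ)
        (S : ℕ → Ω → Metric.sphere (0 : EuclideanSpace ℝ (Fin d)) 1) (σ : ℕ → Ω → Bool),
        IsTwoPointGame K G P ℱ ℓ S σ →
          pseudoRegret K P ℓ
              (played K r δ (R / ((G : ℝ) * d * Real.sqrt n)) ℓ S σ) n ≤
            2 * R * G * d * Real.sqrt n + ε) := by
  have hK : IsCompact K := (isCompact_closedBall 0 R).of_isClosed_subset hKclosed hKR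
  refine ⟨?_, ?_⟩
  · intro n δ η hδ hδr hη Ω mΩ P _ ℱ ℓ S σ h
    refine ⟨fun t ω => ⟨queryPlus_mem hr hK hKconv hrK hδ.le hδr t ω,
      queryMinus_mem hr hK hKconv hrK hδ.le hδr t ω⟩,
      h.integrable_loss_played hr hK hKconv hrK hKR hδ.le hδr,
      h.exists_isMinOn hK ⟨0, hrK (Metric.mem_closedBall_self hr.le)⟩ n, ?_⟩
    refine (h.pseudoRegret_played_le hr hK hKconv hrK hKR hδ hδr hη n).trans ?_
    have h1 : R ^ 2 / (2 * η) ≤ R ^ 2 / η := by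
      gcongr
      linarith
    have h2 : η / 2 * ((G : ℝ) * d) ^ 2 * n ≤ η * ((G : ℝ) * d) ^ 2 * n := by
      gcongr
      linarith
    gcongr
  · intro n hn hG ε hε
    have hlim : Tendsto (fun δ : ℝ => δ * (3 + R / r) * G * n) (𝓝[>] 0) (𝓝 0) := by
      refine tendsto_nhdsWithin_of_tendsto_nhds ?_
      have : Continuous fun δ : ℝ => δ * (3 + R / r) * G * n := by fun_prop
      simpa using this.tendsto 0
    filter_upwards [hlim.eventually_le_const hε, self_mem_nhdsWithin,
      nhdsWithin_le_nhds (eventually_le_nhds hr)] with δ hδε hδ hδr Ω mΩ P _ ℱ ℓ S σ h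
    have hd : 0 < d := dim_pos_of_sphere (IsProbabilityMeasure.ne_zero P) S
    have hd' : (0 : ℝ) < d := by exact_mod_cast hd
    have hn' : (0 : ℝ) < Real.sqrt n := Real.sqrt_pos.2 (by exact_mod_cast hn)
    have hG' : (0 : ℝ) < G := hG
    refine (h.pseudoRegret_played_le hr hK hKconv hrK hKR hδ hδr (by positivity) n).trans ?_
    have hsq : (n : ℝ) = Real.sqrt n ^ 2 := (Real.sq_sqrt n.cast_nonneg).symm
    have e : R ^ 2 / (2 * (R / (G * d * Real.sqrt n))) +
        R / (G * d * Real.sqrt n) / 2 * ((G : ℝ) * d) ^ 2 * Real.sqrt n ^ 2 =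
        R * G * d * Real.sqrt n := by
      field_simp
      ring
    rw [← hsq] at e
    have hpos : 0 < R * G * d * Real.sqrt n := by positivity
    linarith
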